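/- Let $\sigma_x,\sigma_y$ be the Pauli matrices, let $|0,0\rangle,|0,1\rangle\in\mathbb{C}^2$ be orthogonal unit eigenvectors of $\sigma_x$, and let $|1,0\rangle,|1,1\rangle\in\mathbb{C}^2$ be orthogonal unit eigenvectors of $\sigma_y$. Let $\mathfrak{A}=\bigotimes_{i\in\mathbb{N}}M_2(\mathbb{C})$ be the $C^*$-algebraic infinite tensor product, let $\mathfrak{B}$ be a copy of $\mathfrak{A}$, and let $\mathfrak{A}\otimes\mathfrak{B}$ be their $C^*$-tensor product. For $A\in M_2(\mathbb{C})$ let $A^{(i)}\in\mathfrak{A}$ denote $A$ placed at the $i$-th site. The state space of a unital $C^*$-algebra carries the weak* topology and its Borel $\sigma$-algebra; measures on it are positive and regular, and the barycenter of a probability measure $\nu$ on it is the state $a\mapsto\int\omega(a)\,d\nu(\omega)$. (i) For $b\in\{0,1\}$ and $s\in(\mathbb{Z}_2)^{\omega}$ there is a unique state $|b,s\rangle=\bigotimes_{i}|b,s(i)\rangle$ of $\mathfrak{A}$ such that $|b,s\rangle\big(\prod_{i<n}A_i^{(i)}\big)=\prod_{i<n}\langle b,s(i)|A_i|b,s(i)\rangle$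 for all $n$ and all $A_i\in M_2(\mathbb{C})$. There is a unique state $|b,s\rangle_A\otimes|b,s\rangle_B$ of $\mathfrak{A}\otimes\mathfrak{B}$ whose value at each $x\otimes y$ with $x\in\mathfrak{A}$, $y\in\mathfrak{B}$ is the product of the values of $|b,s\rangle$ at $x$ and at $y$. Moreover, $\mathfrak{B}$ has a unique tracial state $\tau$. (ii) Let $\mu$ be the normalized Haar measure on $(\mathbb{Z}_2)^{\omega}$. For each $b\in\{0,1\}$ there is a regular Borel probability measure $\mu_b$ on the state space of $\mathfrak{A}\otimes\mathfrak{B}$ such that, for every Borel set $S\subseteq(\mathbb{Z}_2)^{\omega}$, the set $\{|b,s\rangle_A\otimes|b,s\rangle_B : s\in S\}$ is Borel and $$\mu_b\big(\{|b,s\rangle_A\otimes|b,s\rangle_B : s\in S\}\big)=\mu(S).$$ Furthermore, $\mu_b$ has a barycenter $\rho_b$, and $\rho_b|_{I\otimes\mathfrak{B}}$ is the tracial state: $\rho_b(I\otimes y)=\tau(y)$ for all $y\in\mathfrak{B}$. In particular, $\rho_0$ and $\rho_1$ have the same restriction to $I\otimes\mathfrak{B}$. -/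

import Mathlib

open MeasureTheory
open scoped TensorProduct Matrix ComplexOrder

noncomputable section

/-! ### States of a unital C⋆-algebra -/

section States

variable {A : Type*} [CStarAlgebra A]

/-- The state space of a unital C⋆-algebra: positive normalised continuous linear functionals. -/
def StateSpace (A : Type*) [CStarAlgebra A] : Type _ :=
  {φ : WeakDual ℂ A // (∀ a : A, 0 ≤ φ (star a * a)) ∧ φ 1 = 1}

namespace StateSpace

instance : FunLike (StateSpace A) A ℂ where
  coe ω := ω.1
  coe_injective _ _ h := Subtype.ext (DFunLike.coe_injective h)

/-- The weak-⋆ topology. -/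
instance : TopologicalSpace (StateSpace A) :=
  instTopologicalSpaceSubtype

/-- The Borel σ-algebra of the weak-⋆ topology. -/
instance : MeasurableSpace (StateSpace A) := borel _

instance : BorelSpace (StateSpace A) := ⟨rfl⟩

/-- A state is tracial if it vanishes on commutators. -/
def IsTracial (ω : StateSpace A) : Prop :=
  ∀ a b : A, ω (a * b) = ω (b * a)

/-- `ρ` is the barycenter `ν(K)⁻¹ ∫ ω dν(ω)` of the measure `ν` on the state space `K`; the
integral is taken in the weak-⋆ sense. -/
def IsBarycenter (ν : Measure (StateSpace A)) (ρ : StateSpace A) : Prop :=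
  ∀ a : A, Integrable (fun ω : StateSpace A => ω a) ν ∧
    ρ a = ((ν.real Set.univ)⁻¹ : ℝ) • ∫ ω, ω a ∂ν

end StateSpace

end States

/-! ### The tensor product of two concrete C⋆-algebras -/

section Tensor

variable {H K : Type*} [NormedAddCommGroup H] [InnerProductSpace ℂ H]
  [NormedAddCommGroup K] [InnerProductSpace ℂ K]

/-- The Hilbert space tensor product: the completion of the algebraic tensor product with
`⟪x ⊗ y, x' ⊗ y'⟫ = ⟪x, x'⟫ ⟪y, y'⟫`. -/
def HilbertTensor (H K : Type*) [NormedAddCommGroup H] [InnerProductSpace ℂ H]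
    [NormedAddCommGroup K] [InnerProductSpace ℂ K] : Type _ :=
  UniformSpace.Completion (H ⊗[ℂ] K)

instance : NormedAddCommGroup (HilbertTensor H K) :=
  inferInstanceAs (NormedAddCommGroup (UniformSpace.Completion (H ⊗[ℂ] K)))

instance : InnerProductSpace ℂ (HilbertTensor H K) :=
  inferInstanceAs (InnerProductSpace ℂ (UniformSpace.Completion (H ⊗[ℂ] K)))

instance : CompleteSpace (HilbertTensor H K) :=
  inferInstanceAs (CompleteSpace (UniformSpace.Completion (H ⊗[ℂ] K)))

/-- The canonical isometric embedding of the algebraic tensor product, with dense range. -/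
def toHilbertTensor (H K : Type*) [NormedAddCommGroup H] [InnerProductSpace ℂ H]
    [NormedAddCommGroup K] [InnerProductSpace ℂ K] : H ⊗[ℂ] K →ₗᵢ[ℂ] HilbertTensor H K :=
  UniformSpace.Completion.toComplₗᵢ

/-- The operator `a ⊗ b` on the Hilbert space tensor product: the continuous extension of
`x ⊗ y ↦ a x ⊗ b y`. -/
def opTensor (a : H →L[ℂ] H) (b : K →L[ℂ] K) : HilbertTensor H K →L[ℂ] HilbertTensor H K :=
  ((toHilbertTensor H K).toContinuousLinearMap ∘L TensorProduct.mapL a b).extend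
    (toHilbertTensor H K).toContinuousLinearMap

theorem denseRange_toHilbertTensor (H K : Type*) [NormedAddCommGroup H] [InnerProductSpace ℂ H]
    [NormedAddCommGroup K] [InnerProductSpace ℂ K] : DenseRange (toHilbertTensor H K) :=
  UniformSpace.Completion.denseRange_coe

theorem opTensor_coe (a : H →L[ℂ] H) (b : K →L[ℂ] K) (z : H ⊗[ℂ] K) :
    opTensor a b (toHilbertTensor H K z) = toHilbertTensor H K (TensorProduct.mapL a b z) :=
  ContinuousLinearMap.extend_eq
    (f := (toHilbertTensor H K).toContinuousLinearMap ∘L TensorProduct.mapL a b)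
    (e := (toHilbertTensor H K).toContinuousLinearMap)
    (denseRange_toHilbertTensor H K) (toHilbertTensor H K).isometry.isUniformInducing z

variable [CompleteSpace H] [CompleteSpace K]

/-- The (spatial) C⋆-tensor product of C⋆-algebras of operators: the norm closure of the
⋆-algebra generated by the operators `a ⊗ b`. -/
def cstarTensor (A : StarSubalgebra ℂ (H →L[ℂ] H)) (B : StarSubalgebra ℂ (K →L[ℂ] K)) :
    StarSubalgebra ℂ (HilbertTensor H K →L[ℂ] HilbertTensor H K) :=
  (StarAlgebra.adjoin ℂ {T | ∃ a ∈ A, ∃ b ∈ B, T = opTensor a b}).topologicalClosure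

instance (A : StarSubalgebra ℂ (H →L[ℂ] H)) (B : StarSubalgebra ℂ (K →L[ℂ] K)) :
    IsClosed (cstarTensor A B : Set (HilbertTensor H K →L[ℂ] HilbertTensor H K)) :=
  StarSubalgebra.isClosed_topologicalClosure _

/-- The elementary tensor `a ⊗ b` as an element of the tensor product. -/
def elemTensor {A : StarSubalgebra ℂ (H →L[ℂ] H)} {B : StarSubalgebra ℂ (K →L[ℂ] K)}
    (a : A) (b : B) : cstarTensor A B :=
  ⟨opTensor a.1 b.1, StarSubalgebra.le_topologicalClosure _
    (StarAlgebra.subset_adjoin ℂ _ ⟨a.1, a.2, b.1, b.2, rfl⟩)⟩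

/-- `ω` is the product state `φ ⊗ ψ`: `ω(a ⊗ b) = φ(a) ψ(b)`. -/
def IsProductState {A : StarSubalgebra ℂ (H →L[ℂ] H)} {B : StarSubalgebra ℂ (K →L[ℂ] K)}
    [IsClosed (A : Set (H →L[ℂ] H))] [IsClosed (B : Set (K →L[ℂ] K))] (φ : StateSpace A) (ψ : StateSpace B)
    (ω : StateSpace (cstarTensor A B)) : Prop :=
  ∀ (a : A) (b : B), ω (elemTensor a b) = φ a * ψ b

end Tensor

/-! ### The qubit lattice algebra -/

/-- Configurations of the lattice that are `0` at all but finitely many sites. -/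
abbrev QubitConfig : Type := ℕ →₀ Fin 2

/-- The Hilbert space `ℓ²` over these configurations, i.e. the incomplete infinite tensor product
of copies of `ℂ²` along the reference vector `e₀ ⊗ e₀ ⊗ ⋯`. -/
abbrev QubitHilbert : Type := lp (fun _ : QubitConfig => ℂ) 2

/-- The formula for `A⁽ⁱ⁾ = I ⊗ ⋯ ⊗ I ⊗ A ⊗ I ⊗ ⋯` on functions of the configuration: the matrix
acts on the `i`-th coordinate. -/
def siteFun (i : ℕ) (M : Matrix (Fin 2) (Fin 2) ℂ) (f : QubitConfig → ℂ) (x : QubitConfig) : ℂ :=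
  ∑ k, M (x i) k * f (x.update i k)

theorem siteFun_eq (i : ℕ) (M : Matrix (Fin 2) (Fin 2) ℂ) (f : QubitConfig → ℂ)
    (x : QubitConfig) :
    siteFun i M f x = ∑ k, M (x i) (x i + k) * f (x + Finsupp.single i k) := by
  unfold siteFun
  rw [← Equiv.sum_comp (Equiv.addLeft (x i))]
  refine Finset.sum_congr rfl fun k _ => ?_
  have : x.update i (x i + k) = x + Finsupp.single i k := by
    ext j
    by_cases h : j = i
    · subst h; simp
    · simp [h]
  simp [this]

theorem memℓp_siteFun (i : ℕ) (M : Matrix (Fin 2) (Fin 2) ℂ) {f : QubitConfig → ℂ}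
    (hf : Memℓp f 2) : Memℓp (siteFun i M f) 2 := by
  have h2 : (0 : ℝ) < (2 : ENNReal).toReal := by norm_num
  have h : siteFun i M f = fun x => ∑ k ∈ Finset.univ,
      M (x i) (x i + k) * f (x + Finsupp.single i k) := by
    ext x; exact siteFun_eq i M f x
  rw [h]
  refine Memℓp.finsetSum (E := fun _ : QubitConfig => ℂ) Finset.univ
    (f := fun k x => M (x i) (x i + k) * f (x + Finsupp.single i k)) fun k _ => ?_
  have hk : Memℓp (fun x => f (x + Finsupp.single i k)) 2 := by
    rw [memℓp_gen_iff h2] at hf ⊢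
    exact (Equiv.addRight (Finsupp.single i k)).summable_iff.2 hf
  have hk' := hk.const_mul ((∑ p, ∑ q, ‖M p q‖ : ℝ) : ℂ)
  refine hk'.mono' fun x => ?_
  have hb : ‖M (x i) (x i + k)‖ ≤ ∑ p, ∑ q, ‖M p q‖ :=
    (Finset.single_le_sum (f := fun q => ‖M (x i) q‖) (fun _ _ => norm_nonneg _)
      (Finset.mem_univ _)).trans
      (Finset.single_le_sum (f := fun p => ∑ q, ‖M p q‖)
        (fun _ _ => Finset.sum_nonneg fun _ _ => norm_nonneg _) (Finset.mem_univ _))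
  rw [norm_mul, norm_mul]
  refine mul_le_mul_of_nonneg_right (hb.trans ?_) (norm_nonneg _)
  rw [Complex.norm_real]
  exact le_abs_self _

/-- `A⁽ⁱ⁾` as a linear map on the lattice Hilbert space. -/
def siteLin (i : ℕ) (M : Matrix (Fin 2) (Fin 2) ℂ) : QubitHilbert →ₗ[ℂ] QubitHilbert where
  toFun f := ⟨siteFun i M f, memℓp_siteFun i M (lp.memℓp f)⟩
  map_add' f g := by
    ext x
    change siteFun i M (f + g : QubitHilbert) x = siteFun i M f x + siteFun i M g x
    simp [siteFun, mul_add]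
    ring
  map_smul' c f := by
    ext x
    change siteFun i M (c • f : QubitHilbert) x = c * siteFun i M f x
    simp [siteFun]
    ring

theorem continuous_siteLin (i : ℕ) (M : Matrix (Fin 2) (Fin 2) ℂ) :
    Continuous (siteLin i M) := by
  refine (siteLin i M).continuous_of_seq_closed_graph fun u f g hu hg => ?_
  ext x
  have h1 : ∀ y : QubitConfig, Continuous fun h : QubitHilbert => h y := fun y =>
    (lp.evalCLM ℂ (fun _ : QubitConfig => ℂ) 2 y).continuous
  have h3 := ((h1 x).tendsto g).comp hg
  have h4 : Continuous fun h : QubitHilbert => siteFun i M h x :=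
    continuous_finsetSum _ fun k _ => continuous_const.mul (h1 _)
  exact tendsto_nhds_unique h3 ((h4.tendsto f).comp hu)

/-- `A⁽ⁱ⁾` as a bounded operator on the lattice Hilbert space. -/
def siteOp (i : ℕ) (M : Matrix (Fin 2) (Fin 2) ℂ) : QubitHilbert →L[ℂ] QubitHilbert :=
  ⟨siteLin i M, continuous_siteLin i M⟩

/-- The C⋆-algebra `⨂_{i ∈ ℕ} M₂` of the one-dimensional qubit lattice: the norm closure of the
⋆-algebra generated by all the one-site observables `A⁽ⁱ⁾`. -/
def qubitLattice : StarSubalgebra ℂ (QubitHilbert →L[ℂ] QubitHilbert) :=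
  (StarAlgebra.adjoin ℂ {T | ∃ i M, T = siteOp i M}).topologicalClosure

instance : IsClosed (qubitLattice : Set (QubitHilbert →L[ℂ] QubitHilbert)) :=
  StarSubalgebra.isClosed_topologicalClosure _

/-- `A⁽ⁱ⁾` as an element of the lattice algebra. -/
def site (i : ℕ) (M : Matrix (Fin 2) (Fin 2) ℂ) : qubitLattice :=
  ⟨siteOp i M, StarSubalgebra.le_topologicalClosure _
    (StarAlgebra.subset_adjoin ℂ _ ⟨i, M, rfl⟩)⟩

/-- `φ` is the product state `⨂ᵢ |ξᵢ⟩` given by a sequence of vectors of `ℂ²`: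
`φ(A₀ ⊗ ⋯ ⊗ Aₙ₋₁ ⊗ I ⊗ ⋯) = ∏ᵢ ⟨ξᵢ, Aᵢ ξᵢ⟩`. -/
def IsProductOfKets (ξ : ℕ → EuclideanSpace ℂ (Fin 2)) (φ : StateSpace qubitLattice) : Prop :=
  ∀ (n : ℕ) (M : ℕ → Matrix (Fin 2) (Fin 2) ℂ),
    φ ((List.range n).map fun i => site i (M i)).prod =
      ∏ i ∈ Finset.range n, inner ℂ (ξ i) (Matrix.toEuclideanLin (M i) (ξ i))

/-- The algebra `𝔄 ⊗ 𝔅` of two qubit lattices. -/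
abbrev qubitLatticePair :
    StarSubalgebra ℂ (HilbertTensor QubitHilbert QubitHilbert →L[ℂ]
      HilbertTensor QubitHilbert QubitHilbert) :=
  cstarTensor qubitLattice qubitLattice

/-- The Pauli matrix `σ_x`. -/
def pauliX : Matrix (Fin 2) (Fin 2) ℂ := !![0, 1; 1, 0]

/-- The Pauli matrix `σ_y`. -/
def pauliY : Matrix (Fin 2) (Fin 2) ℂ := !![0, -Complex.I; Complex.I, 0]

end

/-! ### Generating sets of closed ⋆-subalgebras -/

/-! The linear span of the monomials `A₀ ⊗ ⋯ ⊗ Aₙ₋₁ ⊗ I ⊗ ⋯` is dense in the lattice algebra, and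
the span of the elementary tensors is dense in the pair algebra. Continuous functionals are
therefore determined by these elements, which gives every uniqueness claim and reduces weak-⋆
continuity and traciality to them (`qubitLattice_eq_top`, `cstarTensor_eq_top`).

Infinite product vectors need not lie in the Hilbert space, so product states are obtained as
ultrafilter limits of vector states of finite product vectors `ξ₀ ⊗ ⋯ ⊗ ξₙ₋₁ ⊗ e₀ ⊗ ⋯`; on a fixed
monomial these expectations are eventually constant (`exists_isProductOfKets`).

The map `s ↦ |b,s⟩ ⊗ |b,s⟩` is continuous and injective from a compact space to a Hausdorff space,
hence a closed embedding, and `μ_b` is the pushforward of Haar measure along it. The barycenter is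
the integral of this family. On the second factor, independence of the coordinates turns its value
at a monomial into a product of averages of `⟨v, Aᵢ v⟩` over an orthonormal basis, that is `∏
tr(Aᵢ)/2`. This does not depend on the basis and characterises the tracial state. -/

/-- A closed subspace of the C⋆-algebra generated by `G` that contains a multiplicative,
⋆-invariant set of elements comprising the generators is everything. -/
theorem StarAlgebra.eq_top_of_isClosed {B : Type*} [CStarAlgebra B] {G : Set B}
    {S : StarSubalgebra ℂ B} (hS : S = (StarAlgebra.adjoin ℂ G).topologicalClosure) (G' : Set S)
    (hG : ∀ g ∈ G, ∃ x ∈ G', (x : B) = g) (hone : 1 ∈ G')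
    (hmul : ∀ x ∈ G', ∀ y ∈ G', x * y ∈ G') (hstar : ∀ x ∈ G', star x ∈ G')
    (V : Submodule ℂ S) (hV : IsClosed (V : Set S)) (hGV : G' ⊆ V) : V = ⊤ := by
  subst hS
  -- No closure is needed at this stage: the span of `G'` is already a ⋆-algebra, so it exhausts the
  -- algebraic ⋆-algebra generated by `G`.
  have key : ∀ x ∈ StarAlgebra.adjoin ℂ G, ∃ y ∈ Submodule.span ℂ G', (y : B) = x := by
    intro x hx
    induction hx using StarAlgebra.adjoin_induction with
    | mem x h =>
      obtain ⟨y, hy, e⟩ := hG x h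
      exact ⟨y, Submodule.subset_span hy, e⟩
    | algebraMap r =>
      refine ⟨r • 1, Submodule.smul_mem _ _ (Submodule.subset_span hone), ?_⟩
      rw [Algebra.algebraMap_eq_smul_one]
      rfl
    | add x y _ _ hx hy =>
      obtain ⟨x', hx', rfl⟩ := hx
      obtain ⟨y', hy', rfl⟩ := hy
      exact ⟨x' + y', add_mem hx' hy', rfl⟩
    | mul x y _ _ hx hy =>
      obtain ⟨x', hx', rfl⟩ := hx
      obtain ⟨y', hy', rfl⟩ := hy
      refine ⟨x' * y', ?_, rfl⟩
      have h := Submodule.mul_mem_mul hx' hy'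
      rw [Submodule.span_mul_span] at h
      refine Submodule.span_mono ?_ h
      rintro _ ⟨a, ha, b, hb, rfl⟩
      exact hmul a ha b hb
    | star x _ hx =>
      obtain ⟨x', hx', rfl⟩ := hx
      refine ⟨star x', ?_, rfl⟩
      clear * - hx' hstar
      induction hx' using Submodule.span_induction with
      | mem a ha => exact Submodule.subset_span (hstar a ha)
      | zero => simp
      | add a b _ _ ha hb => rw [star_add]; exact add_mem ha hb
      | smul r a _ ha => rw [star_smul]; exact Submodule.smul_mem _ _ ha
  rw [Submodule.eq_top_iff']
  intro x
  have hx : (x : B) ∈ closure (StarAlgebra.adjoin ℂ G : Set B) := x.2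
  rw [← SetLike.mem_coe, ← hV.closure_eq, closure_subtype]
  refine closure_mono ?_ hx
  intro z hz
  obtain ⟨y, hy, rfl⟩ := key z hz
  exact ⟨y, Submodule.span_le.2 hGV hy, rfl⟩

/-! ### One-site observables -/

theorem siteOp_apply (i : ℕ) (M : Matrix (Fin 2) (Fin 2) ℂ) (f : QubitHilbert)
    (x : QubitConfig) : siteOp i M f x = ∑ k, M (x i) k * f (x.update i k) := rfl

theorem siteOp_one (i : ℕ) : siteOp i 1 = 1 := by
  ext f x
  simp only [siteOp_apply, one_apply_eq_self]
  rw [Finset.sum_eq_single (x i)]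
  · simp
  · intro k _ hk
    simp [Matrix.one_apply_ne hk.symm]
  · simp

theorem siteOp_mul (i : ℕ) (M N : Matrix (Fin 2) (Fin 2) ℂ) :
    siteOp i M * siteOp i N = siteOp i (M * N) := by
  ext f x
  simp only [siteOp_apply, mul_apply_eq_comp, Matrix.mul_apply, Finset.mul_sum,
    Finset.sum_mul]
  rw [Finset.sum_comm]
  refine Finset.sum_congr rfl fun k _ => Finset.sum_congr rfl fun l _ => ?_
  have : (x.update i l).update i k = x.update i k := by
    ext j; by_cases h : j = i <;> simp [h]
  simp [this, mul_assoc]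

theorem siteOp_commute {i j : ℕ} (hij : i ≠ j) (M N : Matrix (Fin 2) (Fin 2) ℂ) :
    Commute (siteOp i M) (siteOp j N) := by
  ext f x
  simp only [siteOp_apply, mul_apply_eq_comp, Finset.mul_sum]
  rw [Finset.sum_comm]
  refine Finset.sum_congr rfl fun k _ => Finset.sum_congr rfl fun l _ => ?_
  have : (x.update i l).update j k = (x.update j k).update i l := by
    ext m
    simp only [Finsupp.update_apply]
    split_ifs <;> simp_all
  simp [this, hij, hij.symm]
  ring

/-- Since `k + k = 0` in `Fin 2`, the shift by `Finsupp.single i k` is an involution of the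
configurations. For each `k`, reindexing by it exchanges the summands of the two inner products;
summability allows the sum over `k` to be taken outside. -/
theorem star_siteOp (i : ℕ) (M : Matrix (Fin 2) (Fin 2) ℂ) :
    star (siteOp i M) = siteOp i Mᴴ := by
  rw [ContinuousLinearMap.star_eq_adjoint, eq_comm, ContinuousLinearMap.eq_adjoint_iff]
  intro f g
  have hshift : ∀ (h : QubitHilbert) (k : Fin 2),
      Memℓp (fun x : QubitConfig => h (x + Finsupp.single i k)) 2 := by
    intro h k
    have := lp.memℓp h
    rw [memℓp_gen_iff (by norm_num)] at this ⊢
    exact (Equiv.addRight (Finsupp.single i k)).summable_iff.2 this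
  have hsummable : ∀ (N : Fin 2 → Fin 2 → ℂ) (f g : QubitHilbert) (k : Fin 2),
      Summable fun x : QubitConfig =>
        N (x i) k * inner ℂ (f (x + Finsupp.single i k)) (g x) := by
    intro N f g k
    have h := (lp.summable_inner (𝕜 := ℂ) (⟨_, hshift f k⟩ : QubitHilbert) g).norm.mul_left
      (∑ p, ∑ q, ‖N p q‖)
    refine Summable.of_norm_bounded h fun x => ?_
    rw [norm_mul]
    refine mul_le_mul_of_nonneg_right ?_ (norm_nonneg _)
    exact (Finset.single_le_sum (f := fun q => ‖N (x i) q‖) (fun _ _ => norm_nonneg _)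
      (Finset.mem_univ _)).trans
      (Finset.single_le_sum (f := fun p => ∑ q, ‖N p q‖)
        (fun _ _ => Finset.sum_nonneg fun _ _ => norm_nonneg _) (Finset.mem_univ _))
  have hdouble : ∀ (x : QubitConfig) (k : Fin 2),
      x + Finsupp.single i k + Finsupp.single i k = x := by
    intro x k
    have : k + k = 0 := by fin_cases k <;> rfl
    rw [add_assoc, ← Finsupp.single_add, this, Finsupp.single_zero, add_zero]
  have hleft : ∀ x : QubitConfig, inner ℂ (siteOp i Mᴴ f x) (g x) =
      ∑ k, M (x i + k) (x i) * inner ℂ (f (x + Finsupp.single i k)) (g x) := by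
    intro x
    change inner ℂ (siteFun i Mᴴ f x) (g x) = _
    rw [siteFun_eq, sum_inner]
    refine Finset.sum_congr rfl fun k _ => ?_
    simp [Matrix.conjTranspose_apply]
    ring
  have hright : ∀ x : QubitConfig, inner ℂ (f x) (siteOp i M g x) =
      ∑ k, M (x i) (x i + k) * inner ℂ (f x) (g (x + Finsupp.single i k)) := by
    intro x
    change inner ℂ (f x) (siteFun i M g x) = _
    rw [siteFun_eq, inner_sum]
    refine Finset.sum_congr rfl fun k _ => ?_
    simp
    ring
  rw [lp.inner_eq_tsum, lp.inner_eq_tsum]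
  simp_rw [hleft, hright]
  have hs : ∀ k, Summable fun x : QubitConfig =>
      M (x i + k) (x i) * inner ℂ (f (x + Finsupp.single i k)) (g x) :=
    fun k => hsummable (fun p k => M (p + k) p) f g k
  have he : ∀ k, (fun x : QubitConfig =>
      M (x i) (x i + k) * inner ℂ (f x) (g (x + Finsupp.single i k))) =
      (fun x : QubitConfig =>
        M (x i + k) (x i) * inner ℂ (f (x + Finsupp.single i k)) (g x)) ∘
        Equiv.addRight (Finsupp.single i k) := by
    intro k
    funext x
    have h1 := congrArg (fun y : QubitConfig => y i) (hdouble x k)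
    simp only [Finsupp.add_apply, Finsupp.single_eq_same] at h1
    simp only [Function.comp_apply, Equiv.coe_addRight, hdouble, Finsupp.add_apply,
      Finsupp.single_eq_same, h1]
  rw [Summable.tsum_finsetSum fun k _ => hs k, Summable.tsum_finsetSum fun k _ => ?_]
  · refine Finset.sum_congr rfl fun k _ => ?_
    rw [he k]
    exact (Equiv.tsum_eq (Equiv.addRight (Finsupp.single i k)) _).symm
  · rw [he k]
    exact (Equiv.addRight (Finsupp.single i k)).summable_iff.2 (hs k)

theorem site_one (i : ℕ) : site i 1 = 1 := Subtype.ext (siteOp_one i)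

theorem site_mul (i : ℕ) (M N : Matrix (Fin 2) (Fin 2) ℂ) :
    site i M * site i N = site i (M * N) := Subtype.ext (siteOp_mul i M N)

theorem site_commute {i j : ℕ} (hij : i ≠ j) (M N : Matrix (Fin 2) (Fin 2) ℂ) :
    Commute (site i M) (site j N) := Subtype.ext (siteOp_commute hij M N)

theorem star_site (i : ℕ) (M : Matrix (Fin 2) (Fin 2) ℂ) : star (site i M) = site i Mᴴ :=
  Subtype.ext (star_siteOp i M)

theorem site_add (i : ℕ) (M N : Matrix (Fin 2) (Fin 2) ℂ) :
    site i (M + N) = site i M + site i N := by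
  refine Subtype.ext ?_
  ext f x
  change siteOp i (M + N) f x = siteOp i M f x + siteOp i N f x
  simp only [siteOp_apply, Matrix.add_apply, add_mul, Finset.sum_add_distrib]

theorem site_smul (i : ℕ) (c : ℂ) (M : Matrix (Fin 2) (Fin 2) ℂ) :
    site i (c • M) = c • site i M := by
  refine Subtype.ext ?_
  ext f x
  change siteOp i (c • M) f x = c * siteOp i M f x
  simp only [siteOp_apply, Matrix.smul_apply, smul_eq_mul, mul_assoc, Finset.mul_sum]

/-! ### Monomials `A₀ ⊗ ⋯ ⊗ Aₙ₋₁ ⊗ I ⊗ ⋯` -/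

/-- The monomial `A₀ ⊗ ⋯ ⊗ Aₙ₋₁ ⊗ I ⊗ ⋯`. -/
noncomputable def monomialOp (n : ℕ) (M : ℕ → Matrix (Fin 2) (Fin 2) ℂ) : qubitLattice :=
  ((List.range n).map fun i => site i (M i)).prod

theorem monomialOp_zero (M : ℕ → Matrix (Fin 2) (Fin 2) ℂ) : monomialOp 0 M = 1 := by
  simp [monomialOp]

theorem monomialOp_succ (n : ℕ) (M : ℕ → Matrix (Fin 2) (Fin 2) ℂ) :
    monomialOp (n + 1) M = monomialOp n M * site n (M n) := by
  simp [monomialOp, List.range_succ]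

theorem site_commute_monomialOp {n j : ℕ} (hj : n ≤ j) (N : Matrix (Fin 2) (Fin 2) ℂ)
    (M : ℕ → Matrix (Fin 2) (Fin 2) ℂ) : Commute (site j N) (monomialOp n M) := by
  induction n with
  | zero => rw [monomialOp_zero]; exact Commute.one_right _
  | succ n ih =>
    rw [monomialOp_succ]
    exact (ih (by omega)).mul_right (site_commute (by omega) _ _)

theorem monomialOp_mul (n : ℕ) (M N : ℕ → Matrix (Fin 2) (Fin 2) ℂ) :
    monomialOp n M * monomialOp n N = monomialOp n (fun i => M i * N i) := by
  induction n with
  | zero => simp [monomialOp_zero]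
  | succ n ih =>
    rw [monomialOp_succ, monomialOp_succ, monomialOp_succ, ← ih, ← site_mul]
    simp only [mul_assoc]
    rw [← mul_assoc (site n (M n)) (monomialOp n N),
      (site_commute_monomialOp le_rfl (M n) N).eq, mul_assoc]

theorem star_monomialOp (n : ℕ) (M : ℕ → Matrix (Fin 2) (Fin 2) ℂ) :
    star (monomialOp n M) = monomialOp n (fun i => (M i)ᴴ) := by
  induction n with
  | zero => simp [monomialOp_zero]
  | succ n ih =>
    rw [monomialOp_succ, monomialOp_succ, star_mul, ih, star_site,
      (site_commute_monomialOp le_rfl _ _).eq]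

theorem monomialOp_congr {n : ℕ} {M N : ℕ → Matrix (Fin 2) (Fin 2) ℂ}
    (h : ∀ i < n, M i = N i) : monomialOp n M = monomialOp n N := by
  induction n with
  | zero => simp [monomialOp_zero]
  | succ n ih =>
    rw [monomialOp_succ, monomialOp_succ, ih fun i hi => h i (by omega), h n (by omega)]

/-- A monomial over `n` sites is a monomial over any larger number of sites. -/
theorem monomialOp_eq_of_le {n m : ℕ} (hnm : n ≤ m) (M : ℕ → Matrix (Fin 2) (Fin 2) ℂ) :
    monomialOp n M = monomialOp m (fun i => if i < n then M i else 1) := by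
  induction m, hnm using Nat.le_induction with
  | base => exact monomialOp_congr fun i hi => by simp [hi]
  | succ m hm ih => rw [monomialOp_succ, ← ih, if_neg (by omega), site_one, mul_one]

theorem monomialOp_single (i : ℕ) (A : Matrix (Fin 2) (Fin 2) ℂ) :
    monomialOp (i + 1) (fun j => if j = i then A else 1) = site i A := by
  rw [monomialOp_succ, if_pos rfl,
    monomialOp_congr (N := fun j => if j < 0 then (1 : Matrix (Fin 2) (Fin 2) ℂ) else 1)
      fun j hj => by simp [hj.ne], ← monomialOp_eq_of_le (M := fun _ => 1) (Nat.zero_le i),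
    monomialOp_zero, one_mul]

theorem exists_monomialOp_pair (n m : ℕ) (M N : ℕ → Matrix (Fin 2) (Fin 2) ℂ) :
    ∃ k M' N', monomialOp n M = monomialOp k M' ∧ monomialOp m N = monomialOp k N' :=
  ⟨max n m, _, _, monomialOp_eq_of_le (le_max_left _ _) M,
    monomialOp_eq_of_le (le_max_right _ _) N⟩

/-- Padding with identities brings two monomials to the same length, so monomials are closed under
products and adjoints. -/
theorem qubitLattice_eq_top (V : Submodule ℂ qubitLattice)
    (hV : IsClosed (V : Set qubitLattice)) (h : ∀ n M, monomialOp n M ∈ V) : V = ⊤ := by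
  refine StarAlgebra.eq_top_of_isClosed (S := qubitLattice) rfl
    {x | ∃ n M, x = monomialOp n M} ?_ ?_ ?_ ?_ V hV ?_
  · rintro _ ⟨i, A, rfl⟩
    exact ⟨site i A, ⟨_, _, (monomialOp_single i A).symm⟩, rfl⟩
  · exact ⟨0, 1, (monomialOp_zero _).symm⟩
  · rintro _ ⟨n, M, rfl⟩ _ ⟨m, N, rfl⟩
    obtain ⟨k, M', N', h1, h2⟩ := exists_monomialOp_pair n m M N
    exact ⟨k, _, by rw [h1, h2, monomialOp_mul]⟩
  · rintro _ ⟨n, M, rfl⟩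
    exact ⟨n, _, star_monomialOp n M⟩
  · rintro _ ⟨n, M, rfl⟩
    exact h n M

/-! ### Constructions of states -/

namespace StateSpace

open Filter Topology

section

variable {A : Type*} [CStarAlgebra A]

instance : ContinuousLinearMapClass (StateSpace A) ℂ A ℂ where
  map_add ω := map_add ω.1
  map_smulₛₗ ω := map_smulₛₗ ω.1
  map_continuous ω := ω.1.cont

theorem map_one (ω : StateSpace A) : ω 1 = 1 := ω.2.2

theorem map_star_mul_self_nonneg (ω : StateSpace A) (a : A) : 0 ≤ ω (star a * a) := ω.2.1 a

theorem continuous_eval (a : A) : Continuous fun ω : StateSpace A => ω a :=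
  (WeakDual.eval_continuous a).comp continuous_subtype_val

theorem continuous_of_continuous_eval {X : Type*} [TopologicalSpace X] {f : X → StateSpace A}
    (h : ∀ a, Continuous fun x => f x a) : Continuous f :=
  continuous_induced_rng.2 (WeakDual.continuous_of_continuous_eval h)

instance : T2Space (StateSpace A) :=
  inferInstanceAs (T2Space {φ : WeakDual ℂ A // (∀ a : A, 0 ≤ φ (star a * a)) ∧ φ 1 = 1})

/-- A contractive, positive and normalised linear functional as a state. -/
noncomputable def ofContractive (f : A → ℂ) (hadd : ∀ a b, f (a + b) = f a + f b)
    (hsmul : ∀ (c : ℂ) a, f (c • a) = c * f a) (hbound : ∀ a, ‖f a‖ ≤ ‖a‖)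
    (hpos : ∀ a, 0 ≤ f (star a * a)) (hone : f 1 = 1) : StateSpace A :=
  ⟨StrongDual.toWeakDual (LinearMap.mkContinuous
    { toFun := f, map_add' := hadd, map_smul' := hsmul } 1 (by simpa using hbound)), hpos, hone⟩

/-- The values at `a` stay in the compact disc of radius `‖a‖`, so an ultrafilter limit exists for
every `a`, and linearity, positivity and normalisation pass to the limit. -/
theorem exists_tendsto_ultrafilter {ι : Type*} (F : Ultrafilter ι) (ω : ι → StateSpace A)
    (hω : ∀ i a, ‖ω i a‖ ≤ ‖a‖) :
    ∃ φ : StateSpace A, (∀ a, ‖φ a‖ ≤ ‖a‖) ∧ ∀ a, Tendsto (fun i => ω i a) F (𝓝 (φ a)) := by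
  have hlim : ∀ a : A, ∃ z : ℂ, ‖z‖ ≤ ‖a‖ ∧ Tendsto (fun i => ω i a) F (𝓝 z) := by
    intro a
    obtain ⟨z, hz, h⟩ := (isCompact_closedBall (0 : ℂ) ‖a‖).ultrafilter_le_nhds'
      (F.map fun i => ω i a) (Ultrafilter.mem_map.2
        (Eventually.of_forall fun i => by simpa using hω i a))
    exact ⟨z, by simpa using hz, h⟩
  choose f hf ht using hlim
  refine ⟨ofContractive f (fun a b => ?_) (fun c a => ?_) hf (fun a => ?_) ?_, hf, ht⟩
  · refine tendsto_nhds_unique (ht _) (((ht a).add (ht b)).congr fun i => ?_)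
    rw [map_add]
  · refine tendsto_nhds_unique (ht _) (((ht a).const_mul c).congr fun i => ?_)
    rw [map_smul, smul_eq_mul]
  · exact ge_of_tendsto' (ht _) fun i => map_star_mul_self_nonneg (ω i) a
  · refine tendsto_nhds_unique (ht _) (tendsto_const_nhds.congr fun i => ?_)
    rw [map_one]

/-- Averaging a continuous family of contractive states gives a state. -/
theorem exists_integral {X : Type*} [TopologicalSpace X] [CompactSpace X] [MeasurableSpace X]
    [OpensMeasurableSpace X] (μ : Measure X) [IsProbabilityMeasure μ] {f : X → StateSpace A}
    (hf : Continuous f) (hbound : ∀ x a, ‖f x a‖ ≤ ‖a‖) :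
    ∃ ρ : StateSpace A, ∀ a, Integrable (fun x => f x a) μ ∧ ρ a = ∫ x, f x a ∂μ := by
  have hint : ∀ a, Integrable (fun x => f x a) μ := fun a =>
    ((continuous_eval a).comp hf).integrable_of_hasCompactSupport
      (HasCompactSupport.of_compactSpace _)
  refine ⟨ofContractive (fun a => ∫ x, f x a ∂μ) (fun a b => ?_) (fun c a => ?_) (fun a => ?_)
    (fun a => ?_) ?_, fun a => ⟨hint a, rfl⟩⟩
  · simp only [map_add]
    exact integral_add (hint a) (hint b)
  · simp only [map_smul, smul_eq_mul]
    exact integral_const_mul c _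
  · refine (norm_integral_le_of_norm_le_const (Eventually.of_forall fun x => hbound x a)).trans ?_
    simp
  · exact integral_nonneg fun x => map_star_mul_self_nonneg (f x) a
  · simp [map_one]

/-- A contractive family of states is weak-⋆ continuous if it is so on a set spanning a dense
subspace. -/
theorem continuous_of_submodule {X : Type*} [TopologicalSpace X] {f : X → StateSpace A}
    (hbound : ∀ x a, ‖f x a‖ ≤ ‖a‖) {G : Set A}
    (hG : ∀ V : Submodule ℂ A, IsClosed (V : Set A) → G ⊆ V → V = ⊤)
    (h : ∀ a ∈ G, Continuous fun x => f x a) : Continuous f := by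
  let V : Submodule ℂ A :=
    { carrier := {a | Continuous fun x => f x a}
      add_mem' := fun {a b} ha hb => by
        simp only [Set.mem_ofPred_eq, map_add] at *
        exact ha.add hb
      zero_mem' := by simp only [Set.mem_ofPred_eq, map_zero]; exact continuous_const
      smul_mem' := fun c a ha => by
        simp only [Set.mem_ofPred_eq, map_smul, smul_eq_mul] at *
        exact ha.const_mul c }
  have hV : IsClosed (V : Set A) := by
    refine isClosed_of_closure_subset fun a ha => ?_
    change Continuous fun x => f x a
    -- Contractivity makes `x ↦ f x b` uniformly close to `x ↦ f x a` whenever `b` is close to `a`.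
    refine continuous_of_uniform_approx_of_continuous fun u hu => ?_
    obtain ⟨ε, hε, hεu⟩ := Metric.mem_uniformity_dist.1 hu
    obtain ⟨b, hb, hab⟩ := Metric.mem_closure_iff.1 ha ε hε
    refine ⟨fun x => f x b, hb, fun x => hεu ?_⟩
    rw [dist_eq_norm, ← map_sub]
    exact (hbound x _).trans_lt (by rwa [dist_eq_norm] at hab)
  have htop := hG V hV h
  refine continuous_of_continuous_eval fun a => ?_
  have : a ∈ V := htop ▸ Submodule.mem_top
  exact this

theorem ext_of_submodule {φ ψ : StateSpace A} {G : Set A}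
    (hG : ∀ V : Submodule ℂ A, IsClosed (V : Set A) → G ⊆ V → V = ⊤)
    (h : ∀ a ∈ G, φ a = ψ a) : φ = ψ := by
  let V : Submodule ℂ A := LinearMap.eqLocus (φ : A →ₗ[ℂ] ℂ) (ψ : A →ₗ[ℂ] ℂ)
  have hV : IsClosed (V : Set A) := isClosed_eq (map_continuous φ) (map_continuous ψ)
  have htop := hG V hV h
  refine DFunLike.ext _ _ fun a => ?_
  have : a ∈ V := htop ▸ Submodule.mem_top
  exact this

end

section Vector

variable {H : Type*} [NormedAddCommGroup H] [InnerProductSpace ℂ H]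

theorem norm_inner_apply_le (a : H →L[ℂ] H) {v : H} (hv : ‖v‖ = 1) :
    ‖inner ℂ v (a v)‖ ≤ ‖a‖ := by
  refine (norm_inner_le_norm _ _).trans ?_
  rw [hv, one_mul]
  simpa [hv] using a.le_opNorm v

variable [CompleteSpace H]

/-- The vector state `a ↦ ⟪v, a v⟫`. -/
noncomputable def ofVector (S : StarSubalgebra ℂ (H →L[ℂ] H)) [IsClosed (S : Set (H →L[ℂ] H))]
    (v : H) (hv : ‖v‖ = 1) : StateSpace S :=
  ofContractive (fun a => inner ℂ v ((a : H →L[ℂ] H) v))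
    (fun a b => inner_add_right _ _ _) (fun c a => inner_smul_right _ _ _)
    (fun a => norm_inner_apply_le a hv)
    (fun a => by
      change 0 ≤ inner ℂ v (star (a : H →L[ℂ] H) ((a : H →L[ℂ] H) v))
      rw [ContinuousLinearMap.star_eq_adjoint, ContinuousLinearMap.adjoint_inner_right,
        inner_self_eq_norm_sq_to_K]
      simp)
    (by
      change inner ℂ v v = 1
      rw [inner_self_eq_norm_sq_to_K, hv]
      simp)

theorem norm_ofVector_apply_le (S : StarSubalgebra ℂ (H →L[ℂ] H))
    [IsClosed (S : Set (H →L[ℂ] H))] (v : H) (hv : ‖v‖ = 1) (a : S) :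
    ‖ofVector S v hv a‖ ≤ ‖a‖ := norm_inner_apply_le a hv

end Vector

end StateSpace

/-! ### Elementary tensors -/

section Tensor

variable {H K : Type*} [NormedAddCommGroup H] [InnerProductSpace ℂ H]
  [NormedAddCommGroup K] [InnerProductSpace ℂ K]

theorem opTensor_one : opTensor (1 : H →L[ℂ] H) (1 : K →L[ℂ] K) = 1 := by
  refine ContinuousLinearMap.coeFn_injective ((denseRange_toHilbertTensor H K).equalizer
    (map_continuous _) (map_continuous _) (funext fun z => ?_))
  simp only [Function.comp_apply]
  rw [opTensor_coe]
  change toHilbertTensor H K (TensorProduct.mapL (.id ℂ H) (.id ℂ K) z) = _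
  rw [TensorProduct.mapL_id_id]
  rfl

theorem opTensor_mul (a a' : H →L[ℂ] H) (b b' : K →L[ℂ] K) :
    opTensor a b * opTensor a' b' = opTensor (a * a') (b * b') := by
  refine ContinuousLinearMap.coeFn_injective ((denseRange_toHilbertTensor H K).equalizer
    (map_continuous _) (map_continuous _) (funext fun z => ?_))
  simp only [Function.comp_apply]
  rw [mul_apply_eq_comp, opTensor_coe, opTensor_coe, opTensor_coe]
  congr 1
  induction z with
  | zero => simp
  | tmul x y => rfl
  | add x y hx hy => simp only [map_add, hx, hy]

theorem inner_opTensor_tmul (a : H →L[ℂ] H) (b : K →L[ℂ] K) (x : H) (y : K) :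
    inner ℂ (toHilbertTensor H K (x ⊗ₜ y)) (opTensor a b (toHilbertTensor H K (x ⊗ₜ y))) =
      inner ℂ x (a x) * inner ℂ y (b y) := by
  rw [opTensor_coe, LinearIsometry.inner_map_map, TensorProduct.mapL_tmul,
    TensorProduct.inner_tmul]

variable [CompleteSpace H] [CompleteSpace K]

theorem star_opTensor (a : H →L[ℂ] H) (b : K →L[ℂ] K) :
    star (opTensor a b) = opTensor (star a) (star b) := by
  rw [ContinuousLinearMap.star_eq_adjoint, eq_comm, ContinuousLinearMap.eq_adjoint_iff]
  intro x y
  refine (denseRange_toHilbertTensor H K).induction_on₂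
    (p := fun x y => inner ℂ (opTensor (star a) (star b) x) y = inner ℂ x (opTensor a b y))
    ?_ ?_ x y
  · exact isClosed_eq (by fun_prop) (by fun_prop)
  · intro z w
    rw [opTensor_coe, opTensor_coe, LinearIsometry.inner_map_map, LinearIsometry.inner_map_map]
    induction z with
    | zero => simp
    | add x y hx hy => simp only [map_add, inner_add_left, hx, hy]
    | tmul x y =>
      induction w with
      | zero => simp
      | add x y hx hy => simp only [map_add, inner_add_right, hx, hy]
      | tmul x' y' =>
        rw [TensorProduct.mapL_tmul, TensorProduct.mapL_tmul, TensorProduct.inner_tmul,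
          TensorProduct.inner_tmul, ContinuousLinearMap.star_eq_adjoint,
          ContinuousLinearMap.star_eq_adjoint, ContinuousLinearMap.adjoint_inner_left,
          ContinuousLinearMap.adjoint_inner_left]

theorem cstarTensor_eq_top {A : StarSubalgebra ℂ (H →L[ℂ] H)} {B : StarSubalgebra ℂ (K →L[ℂ] K)}
    (V : Submodule ℂ (cstarTensor A B)) (hV : IsClosed (V : Set (cstarTensor A B)))
    (h : {x | ∃ (a : A) (b : B), x = elemTensor a b} ⊆ (V : Set (cstarTensor A B))) :
    V = ⊤ := by
  refine StarAlgebra.eq_top_of_isClosed (S := cstarTensor A B) rfl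
    {x | ∃ (a : A) (b : B), x = elemTensor a b} ?_ ?_ ?_ ?_ V hV h
  · rintro _ ⟨a, ha, b, hb, rfl⟩
    exact ⟨elemTensor ⟨a, ha⟩ ⟨b, hb⟩, ⟨_, _, rfl⟩, rfl⟩
  · exact ⟨1, 1, Subtype.ext opTensor_one.symm⟩
  · rintro _ ⟨a, b, rfl⟩ _ ⟨a', b', rfl⟩
    exact ⟨a * a', b * b', Subtype.ext (opTensor_mul _ _ _ _)⟩
  · rintro _ ⟨a, b, rfl⟩
    exact ⟨star a, star b, Subtype.ext (star_opTensor _ _)⟩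

end Tensor

/-! ### Finite product vectors and the product states they approximate -/

/-- The reference vector `e₀ ⊗ e₀ ⊗ ⋯`. -/
noncomputable def refVector : QubitHilbert := lp.single 2 0 1

/-- The reference vector is `e₀` at every site, so only the zeroth column of each matrix contributes
and sites from `n` on remain in state `0`. -/
theorem monomialOp_refVector (n : ℕ) (M : ℕ → Matrix (Fin 2) (Fin 2) ℂ) (x : QubitConfig)
    [Decidable (∀ i, n ≤ i → x i = 0)] :
    (monomialOp n M).1 refVector x =
      if ∀ i, n ≤ i → x i = 0 then ∏ i ∈ Finset.range n, M i (x i) 0 else 0 := by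
  classical
  induction n generalizing x with
  | zero =>
    rw [monomialOp_zero]
    change refVector x = _
    have : (∀ i, 0 ≤ i → x i = 0) ↔ x = 0 := by simp [Finsupp.ext_iff]
    simp only [this, refVector, Finset.range_zero, Finset.prod_empty]
    by_cases hx : x = 0
    · subst hx; simp
    · simp [hx]
  | succ n ih =>
    rw [monomialOp_succ, ← (site_commute_monomialOp le_rfl (M n) M).eq]
    change siteOp n (M n) ((monomialOp n M).1 refVector) x = _
    -- The `k = 1` term vanishes: the shorter monomial leaves site `n` in state `0`.
    rw [siteOp_apply, Fin.sum_univ_two, ih, ih, if_neg (c := ∀ i, n ≤ i → x.update n 1 i = 0)]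
    · have h : (∀ i, n ≤ i → x.update n 0 i = 0) ↔ ∀ i, n + 1 ≤ i → x i = 0 := by
        constructor
        · intro h i hi
          simpa [show i ≠ n by omega] using h i (by omega)
        · intro h i hi
          by_cases hin : i = n
          · simp [hin]
          · simpa [hin] using h i (by omega)
      simp only [h]
      split_ifs
      · rw [Finset.prod_range_succ, mul_zero, add_zero, mul_comm]
        congr 1
        refine Finset.prod_congr rfl fun i hi => ?_
        simp [(Finset.mem_range.1 hi).ne]
      · simp
    · intro h
      simpa using h n le_rfl

/-- The matrix with columns `ξ` and `0`. -/
def ketMatrix (ξ : EuclideanSpace ℂ (Fin 2)) : Matrix (Fin 2) (Fin 2) ℂ :=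
  Matrix.of fun j k => if k = 0 then ξ j else 0

/-- `ketMatrix ξ` sends `e₀` to `ξ`, so an expectation in `ξ` becomes one in `e₀`. -/
theorem ketMatrix_conj (ξ : EuclideanSpace ℂ (Fin 2)) (A : Matrix (Fin 2) (Fin 2) ℂ) :
    ((ketMatrix ξ)ᴴ * A * ketMatrix ξ) 0 0 = inner ℂ ξ (Matrix.toEuclideanLin A ξ) := by
  simp [ketMatrix, Matrix.mul_apply, Matrix.toLpLin_apply, PiLp.inner_apply,
    Fin.sum_univ_two]
  ring

/-- The vector `ξ₀ ⊗ ⋯ ⊗ ξₙ₋₁ ⊗ e₀ ⊗ e₀ ⊗ ⋯`. -/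
noncomputable def productVector (ξ : ℕ → EuclideanSpace ℂ (Fin 2)) (n : ℕ) : QubitHilbert :=
  (monomialOp n fun i => ketMatrix (ξ i)).1 refVector

/-- Moving the operator that creates the product vector across the inner product leaves the
reference expectation of one monomial, which is a product of `(0,0)` entries. -/
theorem inner_productVector (ξ : ℕ → EuclideanSpace ℂ (Fin 2)) (n : ℕ)
    (M : ℕ → Matrix (Fin 2) (Fin 2) ℂ) :
    inner ℂ (productVector ξ n) ((monomialOp n M).1 (productVector ξ n)) =
      ∏ i ∈ Finset.range n, inner ℂ (ξ i) (Matrix.toEuclideanLin (M i) (ξ i)) := by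
  classical
  set U := monomialOp n fun i => ketMatrix (ξ i) with hU
  have h : inner ℂ (productVector ξ n) ((monomialOp n M).1 (productVector ξ n)) =
      inner ℂ refVector ((star U * monomialOp n M * U).1 refVector) := by
    change inner ℂ (U.1 refVector) _ =
      inner ℂ refVector (star U.1 ((monomialOp n M).1 (U.1 refVector)))
    rw [ContinuousLinearMap.star_eq_adjoint, ContinuousLinearMap.adjoint_inner_right]
    rfl
  rw [h, hU, star_monomialOp, monomialOp_mul, monomialOp_mul, refVector, lp.inner_single_left,
    ← refVector, monomialOp_refVector, if_pos (by simp)]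
  simp [ketMatrix_conj]

theorem inner_toEuclideanLin_one {ξ : EuclideanSpace ℂ (Fin 2)} (hξ : ‖ξ‖ = 1) :
    inner ℂ ξ (Matrix.toEuclideanLin (1 : Matrix (Fin 2) (Fin 2) ℂ) ξ) = 1 := by
  have : Matrix.toEuclideanLin (1 : Matrix (Fin 2) (Fin 2) ℂ) ξ = ξ := by simp
  rw [this, inner_self_eq_norm_sq_to_K, hξ]
  simp

variable {ξ : ℕ → EuclideanSpace ℂ (Fin 2)}

/-- Padded sites contribute `⟨ξᵢ, ξᵢ⟩ = 1`. Hence the expectation of a fixed monomial is constant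
once `m ≥ n`, which identifies its limit. -/
theorem inner_productVector_of_le (hξ : ∀ i, ‖ξ i‖ = 1) {n m : ℕ} (hnm : n ≤ m)
    (M : ℕ → Matrix (Fin 2) (Fin 2) ℂ) :
    inner ℂ (productVector ξ m) ((monomialOp n M).1 (productVector ξ m)) =
      ∏ i ∈ Finset.range n, inner ℂ (ξ i) (Matrix.toEuclideanLin (M i) (ξ i)) := by
  rw [monomialOp_eq_of_le hnm, inner_productVector,
    ← Finset.prod_subset (Finset.range_mono hnm)]
  · exact Finset.prod_congr rfl fun i hi => by rw [if_pos (Finset.mem_range.1 hi)]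
  · intro i _ hi
    rw [if_neg (by simpa using hi), inner_toEuclideanLin_one (hξ i)]

theorem norm_productVector (hξ : ∀ i, ‖ξ i‖ = 1) (n : ℕ) : ‖productVector ξ n‖ = 1 := by
  have h := inner_productVector_of_le hξ (Nat.zero_le n) (fun _ => 1)
  rw [monomialOp_zero] at h
  change inner ℂ (productVector ξ n) (productVector ξ n) = _ at h
  rw [inner_self_eq_norm_sq_to_K, Finset.range_zero, Finset.prod_empty] at h
  have hsq : ‖productVector ξ n‖ ^ 2 = 1 := Complex.ofReal_injective (by simpa using h)
  exact (pow_eq_one_iff_of_nonneg (norm_nonneg _) two_ne_zero).1 hsq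

/-- Existence of the product state `⨂ᵢ |ξᵢ⟩` and of its tensor square. -/
theorem exists_isProductOfKets (hξ : ∀ i, ‖ξ i‖ = 1) :
    ∃ (φ : StateSpace qubitLattice) (ω : StateSpace qubitLatticePair),
      IsProductOfKets ξ φ ∧ IsProductState φ φ ω ∧ (∀ a, ‖φ a‖ ≤ ‖a‖) ∧ ∀ a, ‖ω a‖ ≤ ‖a‖ := by
  have hpair : ∀ n, ‖toHilbertTensor QubitHilbert QubitHilbert
      (productVector ξ n ⊗ₜ productVector ξ n)‖ = 1 := by
    intro n
    rw [LinearIsometry.norm_map, TensorProduct.norm_tmul, norm_productVector hξ, one_mul]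
  obtain ⟨φ, hφ, hφt⟩ := StateSpace.exists_tendsto_ultrafilter (Filter.hyperfilter ℕ)
    (fun n => StateSpace.ofVector qubitLattice (productVector ξ n) (norm_productVector hξ n))
    fun n a => StateSpace.norm_ofVector_apply_le _ _ _ a
  obtain ⟨ω, hω, hωt⟩ := StateSpace.exists_tendsto_ultrafilter (Filter.hyperfilter ℕ)
    (fun n => StateSpace.ofVector qubitLatticePair _ (hpair n))
    fun n a => StateSpace.norm_ofVector_apply_le _ _ _ a
  refine ⟨φ, ω, fun n M => ?_, fun a b => ?_, hφ, hω⟩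
  · refine tendsto_nhds_unique (hφt (monomialOp n M)) (tendsto_const_nhds.congr' ?_)
    have hev : ∀ᶠ m in (Filter.hyperfilter ℕ : Filter ℕ), n ≤ m :=
      Nat.hyperfilter_le_atTop (Filter.eventually_ge_atTop n)
    filter_upwards [hev] with m hm
    exact (inner_productVector_of_le hξ hm M).symm
  -- Both limits run along the same ultrafilter, and each approximating pair vector is a tensor
  -- square, so the factorisation survives in the limit.
  · refine tendsto_nhds_unique (hωt (elemTensor a b)) (((hφt a).mul (hφt b)).congr fun n => ?_)
    exact (inner_opTensor_tmul a.1 b.1 (productVector ξ n) (productVector ξ n)).symm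

theorem IsProductOfKets.unique {φ ψ : StateSpace qubitLattice} (hφ : IsProductOfKets ξ φ)
    (hψ : IsProductOfKets ξ ψ) : φ = ψ :=
  StateSpace.ext_of_submodule (G := {x | ∃ n M, x = monomialOp n M})
    (fun V hV h => qubitLattice_eq_top V hV fun n M => h ⟨n, M, rfl⟩) (by
      rintro _ ⟨n, M, rfl⟩
      exact (hφ n M).trans (hψ n M).symm)

theorem IsProductState.unique {φ ψ : StateSpace qubitLattice} {ω ω' : StateSpace qubitLatticePair}
    (h : IsProductState φ ψ ω) (h' : IsProductState φ ψ ω') : ω = ω' :=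
  StateSpace.ext_of_submodule (G := {x | ∃ a b, x = elemTensor a b}) cstarTensor_eq_top (by
      rintro _ ⟨a, b, rfl⟩
      exact (h a b).trans (h' a b).symm)

/-! ### The tracial state -/

/-- A linear functional on `2 × 2` matrices that vanishes on commutators is a multiple of the
trace. -/
theorem Matrix.eq_trace_of_tracial (f : Matrix (Fin 2) (Fin 2) ℂ →ₗ[ℂ] ℂ)
    (hf : ∀ A B, f (A * B) = f (B * A)) (A : Matrix (Fin 2) (Fin 2) ℂ) :
    f A = A.trace / 2 * f 1 := by
  have h01 : f !![0, 1; 0, 0] = 0 := by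
    -- With matrix units, `e₀₀ e₀₁ = e₀₁` while `e₀₁ e₀₀ = 0`.
    have h := hf !![1, 0; 0, 0] !![0, 1; 0, 0]
    rw [Matrix.mul_fin_two, Matrix.mul_fin_two] at h
    have h0 : (!![0, 0; 0, 0] : Matrix (Fin 2) (Fin 2) ℂ) = 0 := (Matrix.eta_fin_two 0).symm
    simp only [mul_zero, mul_one, add_zero, h0, map_zero] at h
    exact h
  have h10 : f !![0, 0; 1, 0] = 0 := by
    have h := hf !![0, 0; 0, 1] !![0, 0; 1, 0]
    rw [Matrix.mul_fin_two, Matrix.mul_fin_two] at h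
    have h0 : (!![0, 0; 0, 0] : Matrix (Fin 2) (Fin 2) ℂ) = 0 := (Matrix.eta_fin_two 0).symm
    simp only [mul_zero, mul_one, zero_add, add_zero, h0, map_zero] at h
    exact h
  have h11 : f !![0, 0; 0, 1] = f !![1, 0; 0, 0] := by
    have h := hf !![0, 0; 1, 0] !![0, 1; 0, 0]
    rw [Matrix.mul_fin_two, Matrix.mul_fin_two] at h
    simpa only [mul_zero, mul_one, zero_add, add_zero] using h
  have h1 : f 1 = f !![1, 0; 0, 0] + f !![0, 0; 0, 1] := by
    rw [← map_add]; congr 1; ext i j; fin_cases i <;> fin_cases j <;> simp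
  have hA : A = A 0 0 • !![1, 0; 0, 0] + A 0 1 • !![0, 1; 0, 0] + A 1 0 • !![0, 0; 1, 0] +
      A 1 1 • !![0, 0; 0, 1] := by
    ext i j; fin_cases i <;> fin_cases j <;> simp
  rw [h1, Matrix.trace_fin_two]
  conv_lhs => rw [hA]
  simp only [map_add, map_smul, h01, h10, h11, smul_eq_mul]
  ring

/-- With the first `n` factors fixed, the state is a functional of the matrix at site `n` that
vanishes on commutators, because that site commutes with the earlier ones. It is thus a multiple of
the trace, and one factor splits off. -/
theorem StateSpace.IsTracial.apply_monomialOp {σ : StateSpace qubitLattice} (hσ : σ.IsTracial)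
    (n : ℕ) (M : ℕ → Matrix (Fin 2) (Fin 2) ℂ) :
    σ (monomialOp n M) = ∏ i ∈ Finset.range n, (M i).trace / 2 := by
  induction n with
  | zero => rw [monomialOp_zero, StateSpace.map_one]; simp
  | succ n ih =>
    let f : Matrix (Fin 2) (Fin 2) ℂ →ₗ[ℂ] ℂ :=
      { toFun := fun A => σ (monomialOp n M * site n A)
        map_add' := fun A B => by rw [site_add, mul_add, map_add]
        map_smul' := fun c A => by rw [site_smul, mul_smul_comm, map_smul]; rfl }
    have hf : ∀ A B, f (A * B) = f (B * A) := by
      intro A B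
      change σ (monomialOp n M * site n (A * B)) = σ (monomialOp n M * site n (B * A))
      rw [← site_mul, ← site_mul, ← mul_assoc, hσ, ← mul_assoc,
        (site_commute_monomialOp le_rfl B M).eq, mul_assoc]
    have h := Matrix.eq_trace_of_tracial f hf (M n)
    change σ (monomialOp n M * site n (M n)) = _ * σ (monomialOp n M * site n 1) at h
    rw [monomialOp_succ, h, site_one, mul_one, ih, Finset.prod_range_succ, mul_comm]

theorem StateSpace.IsTracial.unique {σ τ : StateSpace qubitLattice} (hσ : σ.IsTracial)
    (hτ : τ.IsTracial) : σ = τ :=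
  StateSpace.ext_of_submodule (G := {x | ∃ n M, x = monomialOp n M})
    (fun V hV h => qubitLattice_eq_top V hV fun n M => h ⟨n, M, rfl⟩) (by
      rintro _ ⟨n, M, rfl⟩
      rw [hσ.apply_monomialOp, hτ.apply_monomialOp])

/-- Monomials commute under `σ` by `tr(AB) = tr(BA)` at each site; density then extends this to one
argument at a time, so `hclosed` is used twice. -/
theorem StateSpace.isTracial_of_apply_monomialOp {σ : StateSpace qubitLattice}
    (h : ∀ n M, σ (monomialOp n M) = ∏ i ∈ Finset.range n, (M i).trace / 2) : σ.IsTracial := by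
  have hcomm : ∀ n M m N,
      σ (monomialOp n M * monomialOp m N) = σ (monomialOp m N * monomialOp n M) := by
    intro n M m N
    obtain ⟨k, M', N', h1, h2⟩ := exists_monomialOp_pair n m M N
    rw [h1, h2, monomialOp_mul, monomialOp_mul, h, h]
    exact Finset.prod_congr rfl fun i _ => by rw [Matrix.trace_mul_comm]
  have hclosed : ∀ b, (∀ n M, σ (monomialOp n M * b) = σ (b * monomialOp n M)) →
      ∀ a, σ (a * b) = σ (b * a) := by
    intro b hb a
    let V : Submodule ℂ qubitLattice := LinearMap.eqLocus
      ((σ : qubitLattice →ₗ[ℂ] ℂ) ∘ₗ LinearMap.mulRight ℂ b)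
      ((σ : qubitLattice →ₗ[ℂ] ℂ) ∘ₗ LinearMap.mulLeft ℂ b)
    have hV : IsClosed (V : Set qubitLattice) :=
      isClosed_eq ((map_continuous σ).comp (continuous_mul_const b))
        ((map_continuous σ).comp (continuous_const_mul b))
    have : a ∈ V := qubitLattice_eq_top V hV hb ▸ Submodule.mem_top
    exact this
  exact fun a b => hclosed b (fun n M => (hclosed _ (fun m N => hcomm m N n M) b).symm) a

/-! ### Integration over `(ℤ/2)^ω` -/

/-- Under the Haar measure the coordinates are independent and uniformly distributed. -/
theorem integral_prod_coord (μ : Measure (ℕ → ZMod 2)) [μ.IsAddHaarMeasure]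
    [IsProbabilityMeasure μ] (g : ℕ → ZMod 2 → ℂ) (n : ℕ) :
    ∫ s, ∏ i ∈ Finset.range n, g i (s i) ∂μ =
      ∏ i ∈ Finset.range n, (∑ k, g i k) / 2 := by
  induction n with
  | zero => simp
  | succ n ih =>
    have hg : ∀ (h : ZMod 2 → ℂ) i, Continuous fun s : ℕ → ZMod 2 => h (s i) := fun h i =>
      continuous_of_discreteTopology.comp (continuous_apply i)
    have hint : ∀ h : ZMod 2 → ℂ, Integrable
        (fun s : ℕ → ZMod 2 => (∏ i ∈ Finset.range n, g i (s i)) * h (s n)) μ := fun h =>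
      ((continuous_finsetProd _ fun i _ => hg (g i) i).mul
        (hg h n)).integrable_of_hasCompactSupport (HasCompactSupport.of_compactSpace _)
    -- Translation by `Pi.single n 1` flips the `n`-th coordinate and fixes the earlier ones. Adding
    -- the two equal integrals replaces `g n (s n)` by the constant `∑ k, g n k`.
    have htrans : ∫ s, (∏ i ∈ Finset.range n, g i (s i)) * g n (s n) ∂μ =
        ∫ s, (∏ i ∈ Finset.range n, g i (s i)) * g n (1 + s n) ∂μ := by
      rw [← integral_add_left_eq_self
        (fun s : ℕ → ZMod 2 => (∏ i ∈ Finset.range n, g i (s i)) * g n (s n))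
        (Pi.single n 1 : ℕ → ZMod 2)]
      congr 1
      funext s
      congr 1
      · refine Finset.prod_congr rfl fun i hi => ?_
        simp [(Finset.mem_range.1 hi).ne]
      · simp
    have hsum : ∀ z : ZMod 2, g n z + g n (1 + z) = ∑ k, g n k := by
      intro z
      have h2 : ∑ k, g n k = g n 0 + g n 1 := Fin.sum_univ_two (g n)
      have h3 : (1 + 1 : ZMod 2) = 0 := rfl
      rw [h2]
      obtain rfl | rfl : z = 0 ∨ z = 1 := by revert z; decide
      · rw [add_zero]
      · rw [h3, add_comm]
    have hdouble : ∫ s, (∏ i ∈ Finset.range n, g i (s i)) * g n (s n) ∂μ +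
        ∫ s, (∏ i ∈ Finset.range n, g i (s i)) * g n (s n) ∂μ =
        (∏ i ∈ Finset.range n, (∑ k, g i k) / 2) * ∑ k, g n k := by
      nth_rewrite 2 [htrans]
      rw [← integral_add (hint (g n)) (hint fun z => g n (1 + z)), ← ih,
        ← integral_mul_const]
      simp only [← mul_add, hsum]
    simp only [Finset.prod_range_succ]
    linear_combination hdouble / 2

/-! ### Orthonormal bases: the trace and separation of product states -/

theorem sum_inner_toEuclideanLin {v : ZMod 2 → EuclideanSpace ℂ (Fin 2)}
    (hv : Orthonormal ℂ v) (A : Matrix (Fin 2) (Fin 2) ℂ) :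
    ∑ k, inner ℂ (v k) (Matrix.toEuclideanLin A (v k)) = A.trace := by
  have hcard : Fintype.card (ZMod 2) = Module.finrank ℂ (EuclideanSpace ℂ (Fin 2)) := by
    simp
  let B : Module.Basis (ZMod 2) ℂ (EuclideanSpace ℂ (Fin 2)) :=
    basisOfOrthonormalOfCardEqFinrank hv hcard
  have hB : ⇑B = v := coe_basisOfOrthonormalOfCardEqFinrank hv hcard
  have h := LinearMap.trace_eq_sum_inner (Matrix.toEuclideanLin A)
    (B.toOrthonormalBasis (hB ▸ hv))
  simp only [Module.Basis.coe_toOrthonormalBasis, hB] at h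
  rw [← h, Matrix.toEuclideanLin_eq_toLin_orthonormal, Matrix.trace_toLin_eq]

/-- The product states of distinct sequences of basis vectors are distinct. -/
theorem IsProductOfKets.injective {v : ZMod 2 → EuclideanSpace ℂ (Fin 2)}
    (hv : Orthonormal ℂ v) {s t : ℕ → ZMod 2} {φ : StateSpace qubitLattice}
    (hs : IsProductOfKets (fun i => v (s i)) φ) (ht : IsProductOfKets (fun i => v (t i)) φ) :
    s = t := by
  funext i
  by_contra hne
  -- The projection onto `v (s i)`, placed at site `i`, has expectation `1` for `s` and `0` for `t`
  -- when `s i ≠ t i`.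
  let P : Matrix (Fin 2) (Fin 2) ℂ :=
    Matrix.of fun j k => v (s i) j * (starRingEnd ℂ) (v (s i) k)
  have hP : ∀ w : EuclideanSpace ℂ (Fin 2), inner ℂ w (Matrix.toEuclideanLin P w) =
      inner ℂ w (v (s i)) * inner ℂ (v (s i)) w := by
    intro w
    simp [P, Matrix.toLpLin_apply, PiLp.inner_apply, Fin.sum_univ_two]
    ring
  have key : ∀ r : ℕ → ZMod 2, IsProductOfKets (fun i => v (r i)) φ →
      φ (site i P) = inner ℂ (v (r i)) (Matrix.toEuclideanLin P (v (r i))) := by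
    intro r hr
    have h := hr (i + 1) fun j => if j = i then P else 1
    rw [← monomialOp, monomialOp_single] at h
    rw [h, Finset.prod_range_succ, if_pos rfl, Finset.prod_eq_one, one_mul]
    intro j hj
    rw [if_neg (Finset.mem_range.1 hj).ne, inner_toEuclideanLin_one (hv.1 _)]
  have h := (key s hs).symm.trans (key t ht)
  rw [hP, hP, hv.2 hne, mul_zero, inner_self_eq_norm_sq_to_K, hv.1] at h
  simp at h

/-! ### The measures `μ_b` and their barycenters -/

theorem mainTheorem6
    (ket : ZMod 2 → ZMod 2 → EuclideanSpace ℂ (Fin 2))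
    (hket : ∀ b, Orthonormal ℂ (ket b))
    (hket_x : ∀ k, ∃ c : ℂ, Matrix.toEuclideanLin pauliX (ket 0 k) = c • ket 0 k)
    (hket_y : ∀ k, ∃ c : ℂ, Matrix.toEuclideanLin pauliY (ket 1 k) = c • ket 1 k)
    (μ : Measure (ℕ → ZMod 2)) [μ.IsAddHaarMeasure] [IsProbabilityMeasure μ] :
    ∃ (latt : ZMod 2 → (ℕ → ZMod 2) → StateSpace qubitLattice)
      (pair : ZMod 2 → (ℕ → ZMod 2) → StateSpace qubitLatticePair)
      (τ : StateSpace qubitLattice),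
      -- `latt b s` is the unique state `⨂ᵢ |b, s(i)⟩` of the lattice algebra
      (∀ b s φ, IsProductOfKets (fun i => ket b (s i)) φ ↔ φ = latt b s) ∧
      -- `pair b s` is the unique product state `|b, s⟩_A ⊗ |b, s⟩_B`
      (∀ b s ω, IsProductState (latt b s) (latt b s) ω ↔ ω = pair b s) ∧
      -- `τ` is the unique tracial state
      (∀ σ : StateSpace qubitLattice, σ.IsTracial ↔ σ = τ) ∧
      ∀ b : ZMod 2, ∃ ν : Measure (StateSpace qubitLatticePair),
        IsProbabilityMeasure ν ∧ ν.Regular ∧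
        (∀ S : Set (ℕ → ZMod 2), MeasurableSet S →
          MeasurableSet (pair b '' S) ∧ ν (pair b '' S) = μ S) ∧
        ∃ ρ : StateSpace qubitLatticePair, StateSpace.IsBarycenter ν ρ ∧
          ∀ y : qubitLattice, ρ (elemTensor 1 y) = τ y := by
  choose latt pair hlatt hpair hlatt_le hpair_le using fun (b : ZMod 2) (s : ℕ → ZMod 2) =>
    exists_isProductOfKets (ξ := fun i => ket b (s i)) fun i => (hket b).1 (s i)
  have hlatt_cont : ∀ b, Continuous (latt b) := fun b =>
    StateSpace.continuous_of_submodule (hlatt_le b) (G := {x | ∃ n M, x = monomialOp n M})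
      (fun V hV h => qubitLattice_eq_top V hV fun n M => h ⟨n, M, rfl⟩) (by
        rintro _ ⟨n, M, rfl⟩
        have h : (fun s => latt b s (monomialOp n M)) = fun s => ∏ i ∈ Finset.range n,
            inner ℂ (ket b (s i)) (Matrix.toEuclideanLin (M i) (ket b (s i))) :=
          funext fun s => hlatt b s n M
        rw [h]
        refine continuous_finsetProd _ fun i _ => ?_
        exact (continuous_of_discreteTopology (f := fun k : ZMod 2 =>
          (inner ℂ (ket b k) (Matrix.toEuclideanLin (M i) (ket b k)) : ℂ))).comp
            (continuous_apply i))
  have hpair_cont : ∀ b, Continuous (pair b) := fun b =>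
    StateSpace.continuous_of_submodule (hpair_le b) (G := {x | ∃ x' y', x = elemTensor x' y'})
      cstarTensor_eq_top (by
        rintro _ ⟨x, y, rfl⟩
        have h : (fun s => pair b s (elemTensor x y)) = fun s => latt b s x * latt b s y :=
          funext fun s => hpair b s x y
        rw [h]
        exact ((StateSpace.continuous_eval x).comp (hlatt_cont b)).mul
          ((StateSpace.continuous_eval y).comp (hlatt_cont b)))
  have hpair_one : ∀ b s y, pair b s (elemTensor 1 y) = latt b s y := fun b s y => by
    rw [hpair b s 1 y, StateSpace.map_one, one_mul]
  have hpair_inj : ∀ b, Function.Injective (pair b) := by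
    intro b s t hst
    have h : latt b s = latt b t := DFunLike.ext _ _ fun y => by
      rw [← hpair_one, ← hpair_one, hst]
    exact IsProductOfKets.injective (hket b) (hlatt b s) (h ▸ hlatt b t)
  choose avg havg using fun b => StateSpace.exists_integral μ (hlatt_cont b) (hlatt_le b)
  have htracial : ∀ b, (avg b).IsTracial := by
    refine fun b => StateSpace.isTracial_of_apply_monomialOp fun n M => ?_
    have h : (fun s => latt b s (monomialOp n M)) = fun s => ∏ i ∈ Finset.range n,
        inner ℂ (ket b (s i)) (Matrix.toEuclideanLin (M i) (ket b (s i))) :=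
      funext fun s => hlatt b s n M
    rw [(havg b _).2, h, integral_prod_coord μ
      (fun i k => inner ℂ (ket b k) (Matrix.toEuclideanLin (M i) (ket b k)))]
    exact Finset.prod_congr rfl fun i _ => by rw [sum_inner_toEuclideanLin (hket b)]
  -- Either average could serve as `τ`, since both are tracial.
  refine ⟨latt, pair, avg 0, fun b s φ => ⟨fun h => h.unique (hlatt b s), ?_⟩,
    fun b s ω => ⟨fun h => h.unique (hpair b s), ?_⟩,
    fun σ => ⟨fun h => h.unique (htracial 0), ?_⟩, fun b => ?_⟩
  · rintro rfl; exact hlatt b s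
  · rintro rfl; exact hpair b s
  · rintro rfl; exact htracial 0
  -- Compactness of the sequence space makes the image of every Borel set Borel.
  have hemb : MeasurableEmbedding (pair b) :=
    ((hpair_cont b).isClosedEmbedding (hpair_inj b)).measurableEmbedding
  have hprob : IsProbabilityMeasure (μ.map (pair b)) :=
    Measure.isProbabilityMeasure_map hemb.measurable.aemeasurable
  have hinner : (μ.map (pair b)).InnerRegular :=
    Measure.InnerRegular.map_of_continuous (hpair_cont b)
  obtain ⟨ρ, hρ⟩ := StateSpace.exists_integral μ (hpair_cont b) (hpair_le b)
  refine ⟨μ.map (pair b), hprob, inferInstance, fun S hS => ⟨hemb.measurableSet_image.2 hS, ?_⟩,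
    ρ, fun a => ⟨hemb.integrable_map_iff.2 (hρ a).1, ?_⟩, fun y => ?_⟩
  · rw [hemb.map_apply, (hpair_inj b).preimage_image]
  · rw [hemb.integral_map, (hρ a).2, probReal_univ]
    simp
  -- On `I ⊗ 𝔅` the barycenter is `avg b`, and uniqueness of the trace identifies it with `avg 0`.
  · rw [(hρ _).2, (htracial 0).unique (htracial b), (havg b y).2]
    simp only [hpair_one]
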